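/- Let $n\ge 1$, $\mathfrak g=\mathfrak{gl}(n,\mathbb C)$, and let $\mathcal B_n$ be the flag variety of $\mathfrak g$, i.e. the variety of Borel (maximal solvable) subalgebras of $\mathfrak g$, with its Zariski topology. Let $K_n=GL(n-1,\mathbb C)\times GL(1,\mathbb C)\subset GL(n,\mathbb C)$ be the group of invertible block diagonal matrices with an $(n-1)\times(n-1)$ block in the upper left corner and a $1\times 1$ block in the lower right corner, acting on $\mathcal B_n$ by conjugation. Let $\mathfrak k_n=\mathfrak{gl}(n-1,\mathbb C)\oplus\mathfrak{gl}(1,\mathbb C)$ be its Lie algebra of block diagonal matrices, let $\pi_{\mathfrak k_n}:\mathfrak g\to\mathfrak k_n$ be the projection along the $(-1)$-eigenspace of conjugation by $\mathrm{diag}(1,\dots,1,-1)$ (so $\pi_{\mathfrak k_n}$ replaces the off-diagonal blocks by $0$), and let $\mathcal N_{\mathfrak k_n}$ be the set of nilpotent matrices in $\mathfrak k_n$. An element of $\mathfrak{gl}(i,\mathbb C)$ is called regular if its centralizer in $\mathfrak{gl}(i,\mathbb C)$ has dimension $i$. For $x\in\mathfrak g$ and $i\le n$, let $x_i\in\mathfrak{gl}(i,\mathbb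 C)$ be the upper left $i\times i$ corner of $x$; thus $x_n=x$. (a) Let $\mathfrak b\in\mathcal B_n$ be a Borel subalgebra and let $\mathfrak n^{reg}$ be the set of regular nilpotent elements of $\mathfrak g$ contained in $\mathfrak b$. If the orbit $K_n\cdot\mathfrak b$ is not closed in $\mathcal B_n$, then $$\pi_{\mathfrak k_n}(\mathfrak n^{reg})\cap\mathcal N_{\mathfrak k_n}=\emptyset .$$ (b) Let $\mathfrak b\in\mathcal B_n$ and $x\in\mathfrak b$ be such that $x_{n-1}$ and $x_n$ are both regular nilpotent (in $\mathfrak{gl}(n-1,\mathbb C)$ and $\mathfrak{gl}(n,\mathbb C)$ respectively). Then the orbit $K_n\cdot\mathfrak b$ is closed in $\mathcal B_n$. -/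

import Mathlib

open Matrix

attribute [local instance 100] LieRing.ofAssociativeRing

namespace KOrbits

/-- The Lie algebra `gl(n, ℂ)`. -/
abbrev gl (n : ℕ) : Type := Matrix (Fin n) (Fin n) ℂ

/-- A Borel subalgebra of `gl(n, ℂ)`: a maximal solvable Lie subalgebra. -/
def IsBorel {n : ℕ} (b : LieSubalgebra ℂ (gl n)) : Prop :=
  Maximal (fun s : LieSubalgebra ℂ (gl n) => LieAlgebra.IsSolvable s) b

/-- The flag variety of `gl(n, ℂ)`, as the set of its Borel subalgebras. -/
def FlagVariety (n : ℕ) : Type := {b : LieSubalgebra ℂ (gl n) // IsBorel b}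

/-- The Lie algebra automorphism `x ↦ g x g⁻¹` of `gl(n, ℂ)`. -/
noncomputable def adEquiv {n : ℕ} (g : GL (Fin n) ℂ) : gl n ≃ₗ⁅ℂ⁆ gl n :=
  Matrix.lieConj (g : gl n) g.invertible

theorem adEquiv_apply {n : ℕ} (g : GL (Fin n) ℂ) (x : gl n) :
    adEquiv g x = (g : gl n) * x * ((g⁻¹ : GL (Fin n) ℂ) : gl n) := by
  simp [adEquiv]

/-- The image `Ad(g) b` of a Lie subalgebra. -/
noncomputable def adMap {n : ℕ} (g : GL (Fin n) ℂ) (b : LieSubalgebra ℂ (gl n)) :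
    LieSubalgebra ℂ (gl n) :=
  b.map (adEquiv g).toLieHom

theorem mem_adMap {n : ℕ} (g : GL (Fin n) ℂ) (b : LieSubalgebra ℂ (gl n)) (x : gl n) :
    x ∈ adMap g b ↔ ((g⁻¹ : GL (Fin n) ℂ) : gl n) * x * (g : gl n) ∈ b := by
  unfold adMap
  rw [LieSubalgebra.mem_map]
  constructor
  · rintro ⟨y, hy, rfl⟩
    have : (adEquiv g).toLieHom y = (g : gl n) * y * ((g⁻¹ : GL (Fin n) ℂ) : gl n) :=
      adEquiv_apply g y
    rw [this]
    have h1 : ((g⁻¹ : GL (Fin n) ℂ) : gl n) * ((g : gl n) * y * ((g⁻¹ : GL (Fin n) ℂ) : gl n))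
        * (g : gl n) = (((g⁻¹ : GL (Fin n) ℂ) : gl n) * (g : gl n)) * y *
          (((g⁻¹ : GL (Fin n) ℂ) : gl n) * (g : gl n)) := by noncomm_ring
    rw [h1, Units.inv_mul]
    simpa using hy
  · intro h
    refine ⟨_, h, ?_⟩
    refine (adEquiv_apply g _).trans ?_
    have h1 : (g : gl n) * (((g⁻¹ : GL (Fin n) ℂ) : gl n) * x * (g : gl n)) *
        ((g⁻¹ : GL (Fin n) ℂ) : gl n) = ((g : gl n) * ((g⁻¹ : GL (Fin n) ℂ) : gl n)) * x *
          ((g : gl n) * ((g⁻¹ : GL (Fin n) ℂ) : gl n)) := by noncomm_ring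
    rw [h1, Units.mul_inv]
    simp

theorem adMap_one {n : ℕ} (b : LieSubalgebra ℂ (gl n)) : adMap 1 b = b := by
  ext x; rw [mem_adMap]; simp

theorem adMap_mul {n : ℕ} (g h : GL (Fin n) ℂ) (b : LieSubalgebra ℂ (gl n)) :
    adMap (g * h) b = adMap g (adMap h b) := by
  ext x; simp only [mem_adMap, _root_.mul_inv_rev, Units.val_mul, Matrix.mul_assoc]

theorem adMap_mono {n : ℕ} (g : GL (Fin n) ℂ) {b c : LieSubalgebra ℂ (gl n)} (h : b ≤ c) :
    adMap g b ≤ adMap g c := fun x hx => (mem_adMap g c x).2 (h ((mem_adMap g b x).1 hx))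

theorem isSolvable_adMap {n : ℕ} (g : GL (Fin n) ℂ) {b : LieSubalgebra ℂ (gl n)}
    (h : LieAlgebra.IsSolvable b) : LieAlgebra.IsSolvable (adMap g b) :=
  (LieAlgebra.solvable_iff_equiv_solvable ((adEquiv g).lieSubalgebraMap b)).1 h

theorem isBorel_adMap {n : ℕ} (g : GL (Fin n) ℂ) {b : LieSubalgebra ℂ (gl n)}
    (h : IsBorel b) : IsBorel (adMap g b) := by
  refine ⟨isSolvable_adMap g h.1, fun c hc hle => ?_⟩
  have h1 : b ≤ adMap g⁻¹ c := by
    have := adMap_mono g⁻¹ hle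
    rwa [← adMap_mul, inv_mul_cancel, adMap_one] at this
  have h2 := adMap_mono g (h.2 (isSolvable_adMap g⁻¹ hc) h1)
  rwa [← adMap_mul, mul_inv_cancel, adMap_one] at h2

/-- `GL(n, ℂ)` acts on the flag variety by conjugation. -/
noncomputable instance (n : ℕ) : MulAction (GL (Fin n) ℂ) (FlagVariety n) where
  smul g b := ⟨adMap g b.1, isBorel_adMap g b.2⟩
  one_smul b := Subtype.ext (adMap_one b.1)
  mul_smul g h b := Subtype.ext (adMap_mul g h b.1)

/-- The Lie subalgebra of upper triangular matrices. -/
def upperTriangular (n : ℕ) : LieSubalgebra ℂ (gl n) where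
  carrier := {x | ∀ i j, j < i → x i j = 0}
  zero_mem' := fun _ _ _ => rfl
  add_mem' := by
    intro x y hx hy i j h
    simp [hx i j h, hy i j h]
  smul_mem' := by
    intro c x hx i j h
    simp [hx i j h]
  lie_mem' := by
    intro x y hx hy i j h
    have hx' : x.BlockTriangular id := fun i j h => hx i j h
    have hy' : y.BlockTriangular id := fun i j h => hy i j h
    have h1 : (x * y) i j = 0 := (hx'.mul hy') h
    have h2 : (y * x) i j = 0 := (hy'.mul hx') h
    simp [Ring.lie_def, h1, h2]

/-- The upper triangular matrices supported on and above the `k`-th superdiagonal. -/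
def upperIdeal (n k : ℕ) : LieIdeal ℂ (upperTriangular n) where
  carrier := {x | ∀ i j : Fin n, (j : ℕ) < i + k → x.1 i j = 0}
  zero_mem' := fun _ _ _ => rfl
  add_mem' := by
    intro x y hx hy i j h
    simp [hx i j h, hy i j h]
  smul_mem' := by
    intro c x hx i j h
    simp [hx i j h]
  lie_mem := by
    intro x y hy i j h
    simp only [LieSubalgebra.coe_bracket, Ring.lie_def, Matrix.sub_apply, Matrix.mul_apply]
    rw [Finset.sum_eq_zero, Finset.sum_eq_zero, sub_zero]
    · intro l _
      by_cases hl : (l : ℕ) < i + k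
      · simp [hy i l hl]
      · rw [x.2 l j (by rw [Fin.lt_def]; omega), mul_zero]
    · intro l _
      by_cases hl : (l : ℕ) < i
      · rw [x.2 i l hl, zero_mul]
      · rw [hy l j (by omega), mul_zero]

theorem mem_upperIdeal {n k : ℕ} {x : upperTriangular n} :
    x ∈ upperIdeal n k ↔ ∀ i j : Fin n, (j : ℕ) < i + k → x.1 i j = 0 := Iff.rfl

theorem lie_mem_upperIdeal_one {n : ℕ} (x y : upperTriangular n) : ⁅x, y⁆ ∈ upperIdeal n 1 := by
  intro i j h
  rcases lt_or_eq_of_le (Nat.lt_succ_iff.1 h) with h | h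
  · exact (⁅x, y⁆ : upperTriangular n).2 i j h
  · have hij : j = i := Fin.ext h
    subst hij
    have key : ∀ a b : upperTriangular n, (a.1 * b.1) j j = a.1 j j * b.1 j j := by
      intro a b
      rw [Matrix.mul_apply, Finset.sum_eq_single j]
      · intro l _ hl
        rcases lt_or_gt_of_ne hl with h | h
        · rw [a.2 j l h, zero_mul]
        · rw [b.2 l j h, mul_zero]
      · simp
    change (⁅x.1, y.1⁆ : gl n) j j = 0
    rw [Ring.lie_def, Matrix.sub_apply, key, key]
    ring

theorem isSolvable_upperTriangular (n : ℕ) : LieAlgebra.IsSolvable (upperTriangular n) := by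
  have key : ∀ k, LieAlgebra.derivedSeries ℂ (upperTriangular n) k ≤ upperIdeal n k := by
    intro k
    induction k with
    | zero => intro x _ i j h; exact x.2 i j h
    | succ k ih =>
      rw [LieAlgebra.derivedSeries_def, LieAlgebra.derivedSeriesOfIdeal_succ,
        LieSubmodule.lie_le_iff]
      intro x hx y hy
      rcases Nat.eq_zero_or_pos k with rfl | hk
      · exact lie_mem_upperIdeal_one x y
      · have hx' := ih hx
        have hy' := ih hy
        intro i j h
        have aux : ∀ a b : upperTriangular n, a ∈ upperIdeal n k → b ∈ upperIdeal n k →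
            (a.1 * b.1) i j = 0 := by
          intro a b ha hb
          rw [Matrix.mul_apply]
          refine Finset.sum_eq_zero fun l _ => ?_
          by_cases hl : (l : ℕ) < i + k
          · rw [ha i l hl, zero_mul]
          · rw [hb l j (by omega), mul_zero]
        change (⁅x.1, y.1⁆ : gl n) i j = 0
        rw [Ring.lie_def, Matrix.sub_apply, aux x y hx' hy', aux y x hy' hx', sub_zero]
  refine LieAlgebra.IsSolvable.mk (R := ℂ) (k := n) ?_
  rw [eq_bot_iff]
  intro x hx
  have := key n hx
  rw [LieSubmodule.mem_bot]
  ext i j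
  exact this i j (by omega)

theorem isBorel_upperTriangular (n : ℕ) : IsBorel (upperTriangular n) := by
  refine ⟨isSolvable_upperTriangular n, fun s hs hle x hx i j hij => ?_⟩
  by_contra hne
  have hmem : ∀ a b : Fin n, a ≤ b → ∀ c : ℂ, Matrix.single a b c ∈ s := by
    intro a b hab c
    refine hle fun k l hlk => ?_
    rw [Matrix.single_apply, if_neg]
    rintro ⟨rfl, rfl⟩
    exact absurd hab (not_le.2 hlk)
  -- The entry `x i j` below the diagonal gives the lowering operator of an `sl₂` inside `s`.
  have hF : Matrix.single i j (1 : ℂ) ∈ s := by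
    have h1 : ⁅Matrix.single i i (1 : ℂ), ⁅x, Matrix.single j j (1 : ℂ)⁆⁆ ∈ s :=
      s.lie_mem (hmem i i le_rfl 1) (s.lie_mem hx (hmem j j le_rfl 1))
    have h2 : ⁅Matrix.single i i (1 : ℂ), ⁅x, Matrix.single j j (1 : ℂ)⁆⁆ =
        Matrix.single i j (x i j) + Matrix.single j i (x j i) := by
      have e1 : Matrix.single i i (1 : ℂ) * (x * Matrix.single j j 1) =
          Matrix.single i j (x i j) := by
        rw [← Matrix.mul_assoc, Matrix.single_mul_mul_single]; simp
      have e2 : Matrix.single j j (1 : ℂ) * (x * Matrix.single i i 1) =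
          Matrix.single j i (x j i) := by
        rw [← Matrix.mul_assoc, Matrix.single_mul_mul_single]; simp
      have e3 : Matrix.single i i (1 : ℂ) * (Matrix.single j j 1 * x) = 0 := by
        rw [← Matrix.mul_assoc, Matrix.single_mul_single_of_ne _ _ _ _ hij.ne', Matrix.zero_mul]
      have e4 : x * Matrix.single j j (1 : ℂ) * Matrix.single i i 1 = 0 := by
        rw [Matrix.mul_assoc, Matrix.single_mul_single_of_ne _ _ _ _ hij.ne, Matrix.mul_zero]
      simp only [Ring.lie_def, Matrix.mul_sub, Matrix.sub_mul, e1, e3, e4]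
      rw [Matrix.mul_assoc, e2]
      abel
    rw [h2] at h1
    have h3 := s.sub_mem h1 (hmem j i hij.le (x j i))
    rw [add_sub_cancel_right] at h3
    have h4 := s.smul_mem (x i j)⁻¹ h3
    rwa [Matrix.smul_single, smul_eq_mul, inv_mul_cancel₀ hne] at h4
  let E : s := ⟨Matrix.single j i 1, hmem j i hij.le 1⟩
  let F : s := ⟨Matrix.single i j 1, hF⟩
  let H : s := ⁅E, F⁆
  have hH : H.1 = Matrix.single j j 1 - Matrix.single i i 1 := by
    change ⁅Matrix.single j i (1 : ℂ), Matrix.single i j 1⁆ = _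
    simp [Ring.lie_def]
  have hHE : ⁅H, E⁆ = (2 : ℂ) • E := by
    apply Subtype.ext
    change ⁅H.1, Matrix.single j i (1 : ℂ)⁆ = (2 : ℂ) • Matrix.single j i (1 : ℂ)
    rw [hH, Ring.lie_def]
    simp [Matrix.sub_mul, Matrix.mul_sub, hij.ne', two_smul]
  have hHF : ⁅H, F⁆ = (-2 : ℂ) • F := by
    apply Subtype.ext
    change ⁅H.1, Matrix.single i j (1 : ℂ)⁆ = (-2 : ℂ) • Matrix.single i j (1 : ℂ)
    rw [hH, Ring.lie_def]
    simp [Matrix.sub_mul, Matrix.mul_sub, hij.ne, neg_smul, two_smul]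
    abel
  have key : ∀ k, E ∈ LieAlgebra.derivedSeries ℂ s k ∧ F ∈ LieAlgebra.derivedSeries ℂ s k ∧
      H ∈ LieAlgebra.derivedSeries ℂ s k := by
    intro k
    induction k with
    | zero => exact ⟨trivial, trivial, trivial⟩
    | succ k ih =>
      obtain ⟨hE, hF, hH⟩ := ih
      rw [LieAlgebra.derivedSeries_def, LieAlgebra.derivedSeriesOfIdeal_succ,
        ← LieAlgebra.derivedSeries_def]
      refine ⟨?_, ?_, LieSubmodule.lie_mem_lie hE hF⟩
      · have h := LieSubmodule.lie_mem_lie hH hE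
        rw [hHE] at h
        have h' := Submodule.smul_mem (LieSubmodule.toSubmodule _) (2 : ℂ)⁻¹ h
        rwa [smul_smul, inv_mul_cancel₀ two_ne_zero, one_smul] at h'
      · have h := LieSubmodule.lie_mem_lie hH hF
        rw [hHF] at h
        have h' := Submodule.smul_mem (LieSubmodule.toSubmodule _) (-2 : ℂ)⁻¹ h
        rwa [smul_smul, inv_mul_cancel₀ (by norm_num), one_smul] at h'
  obtain ⟨k, hk⟩ := LieAlgebra.IsSolvable.solvable (R := ℂ) (L := s)
  have hE0 := (key k).1
  rw [hk, LieSubmodule.mem_bot] at hE0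
  have h1 : (Matrix.single j i (1 : ℂ)) j i = 0 := by
    have h2 : E.1 = 0 := congrArg Subtype.val hE0
    exact congrFun (congrFun h2 j) i
  simp at h1

/-- The standard Borel subalgebra of upper triangular matrices, as a point of the flag variety. -/
def stdBorel (n : ℕ) : FlagVariety n := ⟨upperTriangular n, isBorel_upperTriangular n⟩

/-- The Zariski topology on `GL(n, ℂ)`: closed sets are the common zero loci of sets of
polynomials in the matrix entries. -/
@[reducible] def zariskiGL (n : ℕ) : TopologicalSpace (GL (Fin n) ℂ) :=
  TopologicalSpace.ofClosed
    {Z | ∃ S : Set (MvPolynomial (Fin n × Fin n) ℂ),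
      Z = {g : GL (Fin n) ℂ | ∀ p ∈ S, MvPolynomial.eval (fun ij => (g : gl n) ij.1 ij.2) p = 0}}
    ⟨{1}, by ext g; simp⟩
    (by
      intro A hA
      choose! S hS using fun Z (hZ : Z ∈ A) => hA hZ
      refine ⟨⋃ Z ∈ A, S Z, ?_⟩
      ext g
      simp only [Set.mem_sInter, Set.mem_iUnion, Set.mem_ofPred_eq]
      constructor
      · rintro h p ⟨Z, hZ, hp⟩
        have := h Z hZ
        rw [hS Z hZ] at this
        exact this p hp
      · intro h Z hZ
        rw [hS Z hZ]
        exact fun p hp => h p ⟨Z, hZ, hp⟩)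
    (by
      rintro _ ⟨S, rfl⟩ _ ⟨T, rfl⟩
      refine ⟨{r | ∃ p ∈ S, ∃ q ∈ T, r = p * q}, ?_⟩
      ext g
      simp only [Set.mem_union, Set.mem_ofPred_eq]
      constructor
      · rintro (h | h) _ ⟨p, hp, q, hq, rfl⟩
        · rw [map_mul, h p hp, zero_mul]
        · rw [map_mul, h q hq, mul_zero]
      · intro h
        by_contra! hc
        obtain ⟨⟨p, hp, hp0⟩, q, hq, hq0⟩ := hc
        have := h _ ⟨p, hp, q, hq, rfl⟩
        rw [map_mul] at this
        exact (mul_ne_zero hp0 hq0) this)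

/-- The Zariski topology on the flag variety, under the identification `G/B ≅ FlagVariety n`,
`gB ↦ Ad(g) b₊`: the quotient topology from the Zariski topology of `GL(n, ℂ)`. -/
noncomputable instance (n : ℕ) : TopologicalSpace (FlagVariety n) :=
  TopologicalSpace.coinduced (fun g : GL (Fin n) ℂ => g • stdBorel n) (zariskiGL n)

/-- Block diagonal matrices of `gl(m+1, ℂ)`, with an `m × m` block in the upper left corner and a
`1 × 1` block in the lower right corner. -/
def IsBlockDiag {m : ℕ} (x : gl (m + 1)) : Prop :=
  ∀ i : Fin m, x i.castSucc (Fin.last m) = 0 ∧ x (Fin.last m) i.castSucc = 0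

/-- The group `K = GL(m, ℂ) × GL(1, ℂ)` of invertible block diagonal matrices
in `GL(m+1, ℂ)`. -/
def K (m : ℕ) : Subgroup (GL (Fin (m + 1)) ℂ) where
  carrier := {g | IsBlockDiag (g : gl (m + 1))}
  one_mem' := fun i => by
    simp [(Fin.castSucc_lt_last i).ne, (Fin.castSucc_lt_last i).ne']
  mul_mem' := by
    intro g h hg hh i
    simp [Matrix.mul_apply, Fin.sum_univ_castSucc, (hg i).1, (hh i).2,
      fun l => (hg l).2, fun l => (hh l).1]
  inv_mem' := by
    intro g hg i
    have h1 : (g : gl (m + 1)) * ((g⁻¹ : GL (Fin (m + 1)) ℂ) : gl (m + 1)) = 1 := Units.mul_inv g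
    have h2 : ((g⁻¹ : GL (Fin (m + 1)) ℂ) : gl (m + 1)) * (g : gl (m + 1)) = 1 := Units.inv_mul g
    have hl := congrFun (congrFun h1 (Fin.last m)) (Fin.last m)
    have hi := congrFun (congrFun h1 (Fin.last m)) i.castSucc
    have hi' := congrFun (congrFun h2 i.castSucc) (Fin.last m)
    simp only [Matrix.mul_apply, Fin.sum_univ_castSucc, fun l => (hg l).1, fun l => (hg l).2,
      zero_mul, mul_zero, Finset.sum_const_zero, zero_add, Matrix.one_apply_eq] at hl hi hi'
    have hne : (g : gl (m + 1)) (Fin.last m) (Fin.last m) ≠ 0 := left_ne_zero_of_mul_eq_one hl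
    rw [Matrix.one_apply_ne (Fin.castSucc_lt_last i).ne'] at hi
    rw [Matrix.one_apply_ne (Fin.castSucc_lt_last i).ne] at hi'
    exact ⟨(mul_eq_zero.1 hi').resolve_right hne, (mul_eq_zero.1 hi).resolve_left hne⟩

/-- The projection of `gl(m+1, ℂ)` onto the block diagonal matrices `gl(m, ℂ) ⊕ gl(1, ℂ)`, along
the `-1`-eigenspace of conjugation by `diag(1, …, 1, -1)`: it keeps the two diagonal blocks and
replaces the off-diagonal ones by zero. -/
def projK {m : ℕ} (x : gl (m + 1)) : gl (m + 1) :=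
  Matrix.of fun i j => if (i = Fin.last m ↔ j = Fin.last m) then x i j else 0

/-- The nilpotent cone of the Lie algebra `gl(m, ℂ) ⊕ gl(1, ℂ)` of block diagonal matrices. -/
def nilconeK (m : ℕ) : Set (gl (m + 1)) := {y | IsBlockDiag y ∧ IsNilpotent y}

/-- The upper left `m × m` corner of a matrix in `gl(m+1, ℂ)`. -/
def corner {m : ℕ} (x : gl (m + 1)) : gl m := x.submatrix Fin.castSucc Fin.castSucc

/-- Regular elements of `gl(n, ℂ)`: the centralizer has dimension `n = rank gl(n, ℂ)`. -/
def IsKostantRegular {n : ℕ} (x : gl n) : Prop :=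
  Module.finrank ℂ (LinearMap.ker (LieAlgebra.ad ℂ (gl n) x)) = n

/-- Regular nilpotent elements of `gl(n, ℂ)`. -/
def IsRegularNilpotent {n : ℕ} (x : gl n) : Prop := IsKostantRegular x ∧ IsNilpotent x

/-- The set of regular nilpotent elements in a Borel subalgebra. -/
def nreg {n : ℕ} (b : FlagVariety n) : Set (gl n) := {x | x ∈ b.1 ∧ IsRegularNilpotent x}

end KOrbits

namespace KOrbits

/-! Both halves follow from one claim: if `b` contains a regular nilpotent `x` whose corner is
nilpotent, then the `K`-orbit of `b` is closed.

Write `b` as the conjugate of the upper triangular matrices by `g`, put `M = g⁻¹ x g`, and let `r`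
be the last row of `g` and `w` the last column of `g⁻¹`. The last diagonal entry of the resolvent
`(t - x)⁻¹` is the ratio of the characteristic polynomials of the corner and of `x`, namely `1/t`.
Hence `r Mᵏ w`, the last diagonal entry of `xᵏ`, vanishes for `k ≥ 1` (`pow_apply_last_eq_zero`).

Regularity makes every superdiagonal entry of `M` nonzero (`superdiag_ne_zero`), so `M` lowers the
top of the support of a vector by exactly one. If `i` is the top index of `w`, the equations for `k
= i, …, 1` successively give `r 0 = 0, …, r (i - 1) = 0`, that is, `g ∈ closedStratum m i`. This
condition is polynomial and cuts out a single double coset of `K` and the upper triangular group, so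
the orbit is closed in the quotient topology. -/

/-! ### Lie's theorem and conjugacy of Borel subalgebras -/

/-- Lie's theorem, iterated: a common eigenvector in the quotient by the span built so far lifts to
the next vector of the flag. -/
theorem exists_invariant_flag {n : ℕ} (b : LieSubalgebra ℂ (gl n)) [LieAlgebra.IsSolvable b]
    (k : ℕ) (hk : k ≤ n) :
    ∃ v : Fin k → (Fin n → ℂ), LinearIndependent ℂ v ∧
      ∀ x ∈ b, ∀ j, x *ᵥ v j ∈ Submodule.span ℂ (v '' Set.Iic j) := by
  induction k with
  | zero => exact ⟨Fin.elim0, linearIndependent_empty_type, fun _ _ j => j.elim0⟩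
  | succ k ih =>
    obtain ⟨v, hv, hinv⟩ := ih (by omega)
    let W : LieSubmodule ℂ b (Fin n → ℂ) :=
      { Submodule.span ℂ (Set.range v) with
        lie_mem := by
          intro x y hy
          change (x : gl n) *ᵥ y ∈ Submodule.span ℂ (Set.range v)
          change y ∈ Submodule.span ℂ (Set.range v) at hy
          induction hy using Submodule.span_induction with
          | mem y h =>
            obtain ⟨j, rfl⟩ := h
            exact Submodule.span_mono (Set.image_subset_range _ _) (hinv x x.2 j)
          | zero => simp
          | add y z _ _ hy hz => rw [mulVec_add]; exact Submodule.add_mem _ hy hz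
          | smul c y _ hy => rw [mulVec_smul]; exact Submodule.smul_mem _ c hy }
    have hW : (W : Submodule ℂ (Fin n → ℂ)) = Submodule.span ℂ (Set.range v) := rfl
    have hne : (W : Submodule ℂ (Fin n → ℂ)) ≠ ⊤ := by
      intro h
      have h1 := finrank_span_eq_card hv
      rw [← hW, h, finrank_top] at h1
      simp at h1
      omega
    have : Nontrivial ((Fin n → ℂ) ⧸ W) := Submodule.Quotient.nontrivial_iff.2 hne
    have : Module.Finite ℂ ((Fin n → ℂ) ⧸ W) :=
      inferInstanceAs (Module.Finite ℂ ((Fin n → ℂ) ⧸ (W : Submodule ℂ (Fin n → ℂ))))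
    obtain ⟨χ, hχ⟩ :=
      LieModule.exists_nontrivial_weightSpace_of_isSolvable ℂ b ((Fin n → ℂ) ⧸ W)
    obtain ⟨⟨q, hq⟩, hq0⟩ := exists_ne (0 : LieModule.weightSpace ((Fin n → ℂ) ⧸ W) χ)
    obtain ⟨w, rfl⟩ := LieSubmodule.Quotient.surjective_mk' W q
    rw [LieModule.mem_weightSpace] at hq
    have hw : w ∉ Submodule.span ℂ (Set.range v) := by
      intro h
      apply hq0
      ext
      exact (LieSubmodule.Quotient.mk_eq_zero' (N := W)).2 h
    refine ⟨Fin.snoc v w, linearIndependent_finSnoc.2 ⟨hv, hw⟩, fun x hx j => ?_⟩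
    have himg : ∀ s : Set (Fin k), v '' s =
        (Fin.snoc v w : Fin (k + 1) → (Fin n → ℂ)) '' (Fin.castSucc '' s) := by
      intro s
      rw [Set.image_image]
      simp
    induction j using Fin.lastCases with
    | cast j =>
      rw [Fin.snoc_castSucc]
      refine Submodule.span_mono ?_ (hinv x hx j)
      rw [himg]
      refine Set.image_mono ?_
      rintro _ ⟨l, hl, rfl⟩
      exact hl
    | last =>
      rw [Fin.snoc_last]
      have h1 := hq ⟨x, hx⟩
      have h2 : x *ᵥ w - χ ⟨x, hx⟩ • w ∈ Submodule.span ℂ (Set.range v) := by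
        rw [← hW]
        refine (LieSubmodule.Quotient.mk_eq_zero' (N := W)).1 ?_
        have h3 : LieSubmodule.Quotient.mk (N := W) (x *ᵥ w) =
            χ ⟨x, hx⟩ • LieSubmodule.Quotient.mk (N := W) w := h1
        change LieSubmodule.Quotient.mk' W _ = 0
        rw [map_sub, map_smul, sub_eq_zero]
        exact h3
      have h4 : x *ᵥ w = (x *ᵥ w - χ ⟨x, hx⟩ • w) + χ ⟨x, hx⟩ • w := by abel
      rw [h4]
      refine Submodule.add_mem _ (Submodule.span_mono ?_ h2)
        (Submodule.smul_mem _ _ (Submodule.subset_span ⟨Fin.last k, Set.mem_Iic.2 le_rfl, ?_⟩))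
      · rw [← Set.image_univ, himg]
        exact Set.image_mono fun l _ => Fin.le_last l
      · simp

/-- `g⁻¹` sends the `l`-th column of `g` to the `l`-th coordinate vector. -/
theorem apply_eq_zero_of_mulVec_mem_span {n : ℕ} (g : GL (Fin n) ℂ) (s : Set (Fin n)) (c : Fin n → ℂ)
    (h : (g : gl n) *ᵥ c ∈ Submodule.span ℂ ((fun j => (g : gl n).col j) '' s)) :
    ∀ j ∉ s, c j = 0 := by
  intro j hj
  have hle : Submodule.span ℂ ((fun j => (g : gl n).col j) '' s) ≤
      LinearMap.ker (LinearMap.proj (R := ℂ) (φ := fun _ : Fin n => ℂ) j ∘ₗ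
        ((g⁻¹ : GL (Fin n) ℂ) : gl n).mulVecLin) := by
    rw [Submodule.span_le]
    rintro _ ⟨l, hl, rfl⟩
    have h1 : (((g⁻¹ : GL (Fin n) ℂ) : gl n) * (g : gl n)) j l = 0 := by
      rw [Units.inv_mul, one_apply_ne]
      rintro rfl
      exact hj hl
    exact h1
  have h2 := hle h
  simpa [mulVec_mulVec] using h2

/-- Every Borel subalgebra is conjugate to the upper triangular matrices. -/
theorem exists_adMap_upperTriangular_eq {n : ℕ} {b : LieSubalgebra ℂ (gl n)} (hb : IsBorel b) :
    ∃ g : GL (Fin n) ℂ, adMap g (upperTriangular n) = b := by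
  have := hb.1
  obtain ⟨v, hv, hinv⟩ := exists_invariant_flag b n le_rfl
  have hu : IsUnit (Matrix.of fun i j => v j i : gl n) :=
    linearIndependent_cols_iff_isUnit.1 hv
  obtain ⟨g, hg⟩ := hu
  have hcol : (fun j => (g : gl n).col j) = v := by
    rw [hg]; rfl
  have hle : b ≤ adMap g (upperTriangular n) := by
    intro x hx
    rw [mem_adMap]
    intro i j hij
    refine apply_eq_zero_of_mulVec_mem_span g (Set.Iic j)
      (fun i => (((g⁻¹ : GL (Fin n) ℂ) : gl n) * x * (g : gl n)) i j) ?_ i (by simpa using hij)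
    rw [hcol]
    have h1 : (g : gl n) *ᵥ (fun i => (((g⁻¹ : GL (Fin n) ℂ) : gl n) * x * (g : gl n)) i j) =
        x *ᵥ v j := by
      have h2 : (g : gl n) * (((g⁻¹ : GL (Fin n) ℂ) : gl n) * x * (g : gl n)) = x * g := by
        rw [← mul_assoc, ← mul_assoc, Units.mul_inv, one_mul]
      rw [← hcol]
      ext i
      exact congrFun (congrFun h2 i) j
    rw [h1]
    exact hinv x hx j
  -- One inclusion suffices: `b` is maximal among solvable subalgebras and the conjugate is
  -- solvable.
  exact ⟨g, le_antisymm
    (hb.2 (isSolvable_adMap g (isSolvable_upperTriangular n)) hle) hle⟩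

theorem exists_smul_stdBorel_eq {n : ℕ} (b : FlagVariety n) :
    ∃ g : GL (Fin n) ℂ, g • stdBorel n = b :=
  (exists_adMap_upperTriangular_eq b.2).imp fun _ h => Subtype.ext h

/-! ### The stabilizer of the standard Borel subalgebra -/

theorem diag_eq_zero_of_isNilpotent {n : ℕ} {M : gl n} (hM : M ∈ upperTriangular n)
    (hnil : IsNilpotent M) (i : Fin n) : M i i = 0 := by
  obtain ⟨k, hk⟩ := hnil
  have key : ∀ k : ℕ, M ^ k ∈ upperTriangular n ∧ (M ^ k) i i = M i i ^ k := by
    intro k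
    induction k with
    | zero => exact ⟨fun a c h => by rw [pow_zero, one_apply_ne h.ne'], by simp⟩
    | succ k ih =>
      refine ⟨fun a c h => ?_, ?_⟩
      · rw [pow_succ]
        have h1 : (M ^ k).BlockTriangular id := fun i j h => ih.1 i j h
        have h2 : M.BlockTriangular id := fun i j h => hM i j h
        exact (h1.mul h2) h
      · rw [pow_succ, mul_apply, Finset.sum_eq_single i, ih.2, pow_succ]
        · intro l _ hl
          rcases lt_or_gt_of_ne hl with h | h
          · rw [ih.1 i l h, zero_mul]
          · rw [hM l i h, mul_zero]
        · simp
  have h1 := (key k).2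
  rw [hk, Matrix.zero_apply] at h1
  exact IsReduced.eq_zero _ ⟨k, h1.symm⟩

theorem isNilpotent_conj {n : ℕ} (g : GL (Fin n) ℂ) {x : gl n} (hx : IsNilpotent x) :
    IsNilpotent (((g⁻¹ : GL (Fin n) ℂ) : gl n) * x * (g : gl n)) := by
  obtain ⟨k, hk⟩ := hx
  exact ⟨k, by rw [Units.conj_pow', hk]; simp⟩

/-- The upper triangular matrices are their own normalizer in `GL(n, ℂ)`. -/
theorem mem_upperTriangular_of_smul_stdBorel {n : ℕ} {g : GL (Fin n) ℂ}
    (h : g • stdBorel n = stdBorel n) : (g : gl n) ∈ upperTriangular n := by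
  -- The test element is the nilpotent Jordan block: `N * g` is `g` with its rows shifted up by one.
  let N : gl n := Matrix.of fun i j => if (i : ℕ) + 1 = j then 1 else 0
  have hN : N ∈ upperTriangular n := by
    intro i j hij
    have : (i : ℕ) + 1 ≠ j := by rw [Fin.lt_def] at hij; omega
    simp [N, this]
  have hNnil : IsNilpotent N := by
    have key : ∀ k : ℕ, ∀ i j : Fin n, (j : ℕ) < i + k → (N ^ k) i j = 0 := by
      intro k
      induction k with
      | zero =>
        intro i j hij
        rw [pow_zero, one_apply_ne]
        rintro rfl
        simp at hij
      | succ k ih =>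
        intro i j hij
        rw [pow_succ, mul_apply]
        refine Finset.sum_eq_zero fun l _ => ?_
        by_cases hl : (l : ℕ) < i + k
        · rw [ih i l hl, zero_mul]
        · have : (l : ℕ) + 1 ≠ j := by omega
          simp [N, this]
    exact ⟨n, by ext i j; exact key n i j (by omega)⟩
  let M : gl n := ((g⁻¹ : GL (Fin n) ℂ) : gl n) * N * (g : gl n)
  have hM : M ∈ upperTriangular n := by
    have h1 : adMap g (upperTriangular n) = upperTriangular n := congrArg Subtype.val h
    rw [← mem_adMap, h1]
    exact hN
  have hM0 := diag_eq_zero_of_isNilpotent hM (isNilpotent_conj g hNnil)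
  have hcomm : N * (g : gl n) = (g : gl n) * M := by
    simp only [M, ← mul_assoc, Units.mul_inv, one_mul]
  -- Induction on the column. As `M` is strictly upper triangular, `N * g = g * M` expresses an
  -- entry of column `j` through earlier columns, one row higher and still below the diagonal.
  suffices H : ∀ k : ℕ, ∀ j i : Fin n, (j : ℕ) = k → j < i → (g : gl n) i j = 0 from
    fun i j hij => H j j i rfl hij
  intro k
  induction k using Nat.strong_induction_on with
  | _ k ih =>
    intro j i hj hij
    obtain ⟨i', hi'⟩ : ∃ i' : Fin n, (i' : ℕ) + 1 = i :=
      ⟨⟨i - 1, by omega⟩, by rw [Fin.lt_def] at hij; simp only []; omega⟩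
    have h1 := congrFun (congrFun hcomm i') j
    rw [mul_apply, Finset.sum_eq_single i] at h1
    · simp only [N, of_apply, hi', if_true, one_mul] at h1
      rw [h1, mul_apply]
      refine Finset.sum_eq_zero fun l _ => ?_
      rcases lt_trichotomy l j with hl | rfl | hl
      · rw [ih l (by rw [Fin.lt_def] at hl; omega) l i' rfl
          (by rw [Fin.lt_def] at hl hij ⊢; omega), zero_mul]
      · rw [hM0, mul_zero]
      · rw [hM l j hl, mul_zero]
    · intro l _ hl
      have : (i' : ℕ) + 1 ≠ l := fun h => hl (Fin.ext (by omega))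
      simp [N, this]
    · simp

theorem smul_stdBorel_of_mem_upperTriangular {n : ℕ} {u : GL (Fin n) ℂ}
    (hu : (u : gl n) ∈ upperTriangular n) : u • stdBorel n = stdBorel n := by
  have h1 : (u : gl n).BlockTriangular id := fun i j h => hu i j h
  have h2 : ((u⁻¹ : GL (Fin n) ℂ) : gl n).BlockTriangular id := by
    have : Invertible (u : gl n) := u.invertible
    rw [coe_units_inv]
    exact blockTriangular_inv_of_blockTriangular h1
  have hle : upperTriangular n ≤ adMap u (upperTriangular n) := by
    intro x hx
    have h3 : x.BlockTriangular id := fun i j h => hx i j h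
    rw [mem_adMap]
    exact fun i j h => ((h2.mul h3).mul h1) h
  exact Subtype.ext (le_antisymm ((isBorel_upperTriangular n).2
    (isBorel_adMap u (isBorel_upperTriangular n)).1 hle) hle)

/-! ### Characteristic polynomials and the resolvent -/

theorem charpoly_eq_X_pow_of_isNilpotent {n : ℕ} {x : gl n} (hx : IsNilpotent x) :
    x.charpoly = Polynomial.X ^ n := by
  have h := (Matrix.isNilpotent_charpoly_sub_pow_of_isNilpotent hx).eq_zero
  rw [sub_eq_zero] at h
  simpa using h

/-- If `x` and its corner are nilpotent, then all positive powers of `x` have zero last diagonal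
entry. -/
theorem pow_apply_last_eq_zero {m : ℕ} {x : gl (m + 1)} (hx : IsNilpotent x)
    (hc : IsNilpotent (corner x)) (k : ℕ) (hk : 1 ≤ k) :
    (x ^ k) (Fin.last m) (Fin.last m) = 0 := by
  have hpow : x ^ (m + 1) = 0 := by
    have := Matrix.aeval_self_charpoly x
    rwa [charpoly_eq_X_pow_of_isNilpotent hx, map_pow, Polynomial.aeval_X] at this
  by_cases hkm : m < k
  · rw [show k = (m + 1) + (k - (m + 1)) by omega, pow_add, hpow, zero_mul, Matrix.zero_apply]
  let t : Matrix (Fin (m + 1)) (Fin (m + 1)) (Polynomial ℂ) := scalar (Fin (m + 1)) Polynomial.X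
  let y : Matrix (Fin (m + 1)) (Fin (m + 1)) (Polynomial ℂ) := Polynomial.C.mapMatrix x
  have hcomm : Commute t y := scalar_commute _ (Commute.all _) _
  have hA : charmatrix x = t - y := rfl
  -- The geometric sum telescopes to `X ^ (m + 1)`, which is also the determinant of `charmatrix x`;
  -- so the sum is the adjugate.
  have hsum : charmatrix x * (∑ i ∈ Finset.range (m + 1), t ^ i * y ^ (m + 1 - 1 - i)) =
      charmatrix x * adjugate (charmatrix x) := by
    rw [hA, hcomm.mul_geom_sum₂, ← hA, mul_adjugate, ← map_pow Polynomial.C.mapMatrix, hpow,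
      map_zero, sub_zero]
    change _ = x.charpoly • _
    rw [charpoly_eq_X_pow_of_isNilpotent hx, ← map_pow]
    ext i j
    simp [diagonal_apply, one_apply]
  have hsum' : (∑ i ∈ Finset.range (m + 1), t ^ i * y ^ (m + 1 - 1 - i)) =
      adjugate (charmatrix x) := by
    have h1 := congrArg (adjugate (charmatrix x) * ·) hsum
    simp only [← mul_assoc, adjugate_mul, smul_mul, one_mul] at h1
    have h2 : (charmatrix x).det ≠ 0 := x.charpoly_monic.ne_zero
    exact smul_right_injective _ h2 h1
  -- The last diagonal cofactor of `charmatrix x` is the characteristic polynomial of the corner.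
  have hadj : adjugate (charmatrix x) (Fin.last m) (Fin.last m) = Polynomial.X ^ m := by
    rw [adjugate_fin_succ_eq_det_submatrix, ← charpoly_eq_X_pow_of_isNilpotent hc]
    rw [Even.neg_one_pow ⟨_, rfl⟩, one_mul, Matrix.charpoly]
    congr 1
    ext i j : 2
    simp [charmatrix_apply, corner, diagonal_apply]
  -- The coefficient of `X ^ (m - k)` isolates the entry of `x ^ k`; since `k ≥ 1`, it is zero in `X
  -- ^ m`.
  have h3 := congrArg (fun A => (A (Fin.last m) (Fin.last m)).coeff (m - k)) hsum'
  simp only [hadj, Polynomial.coeff_X_pow] at h3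
  rw [if_neg (by omega), Matrix.sum_apply, Polynomial.finsetSum_coeff,
    Finset.sum_eq_single (m - k)] at h3
  · have h4 : (t ^ (m - k) * y ^ (m + 1 - 1 - (m - k))) (Fin.last m) (Fin.last m) =
        Polynomial.X ^ (m - k) * Polynomial.C ((x ^ k) (Fin.last m) (Fin.last m)) := by
      rw [show m + 1 - 1 - (m - k) = k by omega, ← map_pow, ← map_pow]
      simp [scalar_apply, diagonal_mul]
    rw [h4] at h3
    simpa using h3
  · intro i hi hne
    have h4 : (t ^ i * y ^ (m + 1 - 1 - i)) (Fin.last m) (Fin.last m) =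
        Polynomial.X ^ i * Polynomial.C ((x ^ (m + 1 - 1 - i)) (Fin.last m) (Fin.last m)) := by
      rw [← map_pow, ← map_pow]
      simp [scalar_apply, diagonal_mul]
    rw [h4, mul_comm, Polynomial.coeff_C_mul_X_pow, if_neg hne.symm]
  · intro h
    exact absurd (Finset.mem_range.2 (by omega)) h

/-! ### Regular nilpotent upper triangular matrices -/

theorem isKostantRegular_adEquiv_iff {n : ℕ} (g : GL (Fin n) ℂ) {x : gl n} :
    IsKostantRegular (adEquiv g x) ↔ IsKostantRegular x := by
  have h : LinearMap.ker (LieAlgebra.ad ℂ (gl n) (adEquiv g x)) =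
      (LinearMap.ker (LieAlgebra.ad ℂ (gl n) x)).map
        ((adEquiv g).toLinearEquiv : gl n →ₗ[ℂ] gl n) := by
    ext y
    rw [Submodule.mem_map_equiv, LinearMap.mem_ker, LinearMap.mem_ker, LieAlgebra.ad_apply,
      LieAlgebra.ad_apply]
    obtain ⟨z, rfl⟩ := (adEquiv g).toLinearEquiv.surjective y
    rw [LinearEquiv.symm_apply_apply]
    change ⁅adEquiv g x, adEquiv g z⁆ = 0 ↔ _
    rw [← LieEquiv.map_lie, EmbeddingLike.map_eq_zero_iff]
  unfold IsKostantRegular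
  rw [h, LinearEquiv.finrank_map_eq]

/-- A regular nilpotent upper triangular matrix has no zero on the first superdiagonal. -/
theorem superdiag_ne_zero {n : ℕ} {M : gl n} (hM : M ∈ upperTriangular n)
    (hreg : IsRegularNilpotent M) {i j : Fin n} (hij : (i : ℕ) + 1 = j) : M i j ≠ 0 := by
  intro h0
  have hdiag := diag_eq_zero_of_isNilpotent hM hreg.2
  have hlt : i < j := by rw [Fin.lt_def]; omega
  -- If `M i j = 0`, then `ad M` on the upper triangular matrices has image inside the kernel of the
  -- rank `n + 1` map `φ`. By rank-nullity the centralizer of `M` has dimension at least `n + 1`,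
  -- against regularity.
  let φ : upperTriangular n →ₗ[ℂ] (Fin n → ℂ) × ℂ :=
    { toFun := fun x => (fun l => x.1 l l, x.1 i j)
      map_add' := fun _ _ => rfl
      map_smul' := fun _ _ => rfl }
  have hφ : Function.Surjective φ := by
    rintro ⟨d, c⟩
    refine ⟨⟨diagonal d + single i j c, fun k l hlk => ?_⟩, ?_⟩
    · rw [Matrix.add_apply, diagonal_apply_ne _ hlk.ne', single_apply, if_neg, add_zero]
      rintro ⟨rfl, rfl⟩
      exact lt_asymm hlt hlk
    · refine Prod.ext (funext fun l => ?_) ?_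
      · change (diagonal d + single i j c) l l = d l
        rw [Matrix.add_apply, diagonal_apply_eq, single_apply, if_neg, add_zero]
        rintro ⟨rfl, rfl⟩
        exact hlt.ne rfl
      · change (diagonal d + single i j c) i j = c
        simp [diagonal_apply_ne _ hlt.ne]
  let ψ : upperTriangular n →ₗ[ℂ] upperTriangular n :=
    (LieAlgebra.ad ℂ (upperTriangular n) ⟨M, hM⟩ : Module.End ℂ (upperTriangular n))
  have hrange : LinearMap.range ψ ≤ LinearMap.ker φ := by
    rintro _ ⟨y, rfl⟩
    rw [LinearMap.mem_ker]
    have hb : ∀ k l : Fin n, (l : ℕ) < k + 1 → (ψ y).1 k l = 0 := fun k l h =>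
      lie_mem_upperIdeal_one (⟨M, hM⟩ : upperTriangular n) y k l h
    refine Prod.ext (funext fun l => hb l l (by omega)) ?_
    change (M * y.1 - y.1 * M) i j = 0
    have h1 : (M * y.1) i j = 0 := by
      rw [mul_apply]
      refine Finset.sum_eq_zero fun l _ => ?_
      rcases lt_trichotomy (l : ℕ) (i : ℕ) with h | h | h
      · rw [hM i l h, zero_mul]
      · rw [Fin.ext h, hdiag, zero_mul]
      · rcases eq_or_ne l j with rfl | hne
        · rw [h0, zero_mul]
        · rw [y.2 l j (by rw [Fin.lt_def]; have := Fin.val_ne_of_ne hne; omega), mul_zero]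
    have h2 : (y.1 * M) i j = 0 := by
      rw [mul_apply]
      refine Finset.sum_eq_zero fun l _ => ?_
      rcases lt_trichotomy (l : ℕ) (j : ℕ) with h | h | h
      · rcases eq_or_ne l i with rfl | hne
        · rw [h0, mul_zero]
        · rw [y.2 i l (by rw [Fin.lt_def]; have := Fin.val_ne_of_ne hne; omega), zero_mul]
      · rw [Fin.ext h, hdiag, mul_zero]
      · rw [hM l j h, mul_zero]
    rw [Matrix.sub_apply, h1, h2, sub_zero]
  have hker : Module.finrank ℂ (LinearMap.ker ψ) ≤ n := by
    have hle : (LinearMap.ker ψ).map (upperTriangular n).toSubmodule.subtype ≤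
        LinearMap.ker (LieAlgebra.ad ℂ (gl n) M) := by
      rintro _ ⟨y, hy, rfl⟩
      exact congrArg Subtype.val (LinearMap.mem_ker.1 hy)
    have h1 := Submodule.finrank_mono hle
    rw [Submodule.finrank_map_subtype_eq (upperTriangular n).toSubmodule, hreg.1] at h1
    exact h1
  have e1 := LinearMap.finrank_range_add_finrank_ker ψ
  have e2 := LinearMap.finrank_range_add_finrank_ker φ
  have e3 := Submodule.finrank_mono hrange
  rw [LinearMap.range_eq_top.2 hφ, finrank_top, Module.finrank_prod, Module.finrank_fin_fun,
    Module.finrank_self] at e2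
  omega

/-! ### Closed strata and closed orbits -/

/-- The elements `g` whose flag, spanned by the columns of `g`, has its first `i` vectors in the
hyperplane of the first `m` coordinates and the last coordinate vector in the span of the first
`i + 1` vectors. -/
def closedStratum (m : ℕ) (i : Fin (m + 1)) : Set (GL (Fin (m + 1)) ℂ) :=
  {g | (∀ j < i, (g : gl (m + 1)) (Fin.last m) j = 0) ∧
    ∀ j, i < j → ((g⁻¹ : GL (Fin (m + 1)) ℂ) : gl (m + 1)) j (Fin.last m) = 0}

/-- Entries of `g⁻¹` are not polynomial in `g`, but they vanish exactly when those of the adjugate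
do. -/
theorem isClosed_closedStratum (m : ℕ) (i : Fin (m + 1)) :
    @IsClosed _ (zariskiGL (m + 1)) (closedStratum m i) := by
  let _ := zariskiGL (m + 1)
  let P : Matrix (Fin (m + 1)) (Fin (m + 1)) (MvPolynomial (Fin (m + 1) × Fin (m + 1)) ℂ) :=
    mvPolynomialX _ _ ℂ
  refine ⟨?_⟩
  change (closedStratum m i)ᶜᶜ ∈ _
  rw [compl_compl]
  refine ⟨(fun j => P (Fin.last m) j) '' Set.Iio i ∪
    (fun j => adjugate P j (Fin.last m)) '' Set.Ioi i, ?_⟩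
  ext g
  have hadj : ∀ j, MvPolynomial.eval (fun ij => (g : gl (m + 1)) ij.1 ij.2)
      (adjugate P j (Fin.last m)) = adjugate (g : gl (m + 1)) j (Fin.last m) := by
    intro j
    have h := RingHom.map_adjugate
      (MvPolynomial.eval (fun ij : Fin (m + 1) × Fin (m + 1) => (g : gl (m + 1)) ij.1 ij.2)) P
    rw [mvPolynomialX_mapMatrix_eval] at h
    exact congrFun (congrFun h j) (Fin.last m)
  have hdet : (g : gl (m + 1)).det ≠ 0 :=
    ((isUnit_iff_isUnit_det _).1 g.isUnit).ne_zero
  have hinv : ∀ j, ((g⁻¹ : GL (Fin (m + 1)) ℂ) : gl (m + 1)) j (Fin.last m) = 0 ↔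
      adjugate (g : gl (m + 1)) j (Fin.last m) = 0 := by
    intro j
    rw [coe_units_inv, inv_def, Matrix.smul_apply, smul_eq_zero, Ring.inverse_eq_inv',
      inv_eq_zero, or_iff_right hdet]
  simp only [closedStratum, Set.mem_ofPred_eq, Set.mem_union, Set.mem_image, Set.mem_Iio,
    Set.mem_Ioi, hinv]
  constructor
  · rintro ⟨h1, h2⟩ p (⟨j, hj, rfl⟩ | ⟨j, hj, rfl⟩)
    · simpa [P] using h1 j hj
    · rw [hadj, h2 j hj]
  · intro h
    refine ⟨fun j hj => ?_, fun j hj => ?_⟩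
    · simpa [P] using h _ (Or.inl ⟨j, hj, rfl⟩)
    · rw [← hadj]
      exact h _ (Or.inr ⟨j, hj, rfl⟩)

/-- A block diagonal `k` only rescales the last row of `g` and the last column of `g⁻¹`. -/
theorem mul_mem_closedStratum_of_mem_K {m : ℕ} {i : Fin (m + 1)} {k g : GL (Fin (m + 1)) ℂ}
    (hk : k ∈ K m) (hg : g ∈ closedStratum m i) : k * g ∈ closedStratum m i := by
  have hk' := (K m).inv_mem hk
  refine ⟨fun j hj => ?_, fun j hj => ?_⟩
  · rw [Units.val_mul, mul_apply, Fin.sum_univ_castSucc, hg.1 j hj]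
    simp [fun l => (hk l).2]
  · rw [_root_.mul_inv_rev, Units.val_mul, mul_apply, Fin.sum_univ_castSucc, hg.2 j hj]
    simp only [fun l => (hk' l).1, mul_zero, Finset.sum_const_zero, zero_mul, add_zero]

theorem mul_mem_closedStratum_of_mem_upperTriangular {m : ℕ} {i : Fin (m + 1)}
    {g u : GL (Fin (m + 1)) ℂ} (hg : g ∈ closedStratum m i)
    (hu : (u : gl (m + 1)) ∈ upperTriangular (m + 1))
    (hu' : ((u⁻¹ : GL (Fin (m + 1)) ℂ) : gl (m + 1)) ∈ upperTriangular (m + 1)) :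
    g * u ∈ closedStratum m i := by
  refine ⟨fun j hj => ?_, fun j hj => ?_⟩
  · rw [Units.val_mul, mul_apply]
    refine Finset.sum_eq_zero fun l _ => ?_
    rcases lt_or_ge j l with h | h
    · rw [hu l j h, mul_zero]
    · rw [hg.1 l (h.trans_lt hj), zero_mul]
  · rw [_root_.mul_inv_rev, Units.val_mul, mul_apply]
    refine Finset.sum_eq_zero fun l _ => ?_
    rcases lt_or_ge l j with h | h
    · rw [hu' j l h, zero_mul]
    · rw [hg.2 l (hj.trans_le h), mul_zero]

/-- Every element of the stratum can be moved by the upper triangular group to one whose last row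
and `i`-th column are coordinate vectors. -/
theorem exists_mul_upperTriangular_of_mem_closedStratum {m : ℕ} {i : Fin (m + 1)}
    {g : GL (Fin (m + 1)) ℂ} (hg : g ∈ closedStratum m i) :
    ∃ u : GL (Fin (m + 1)) ℂ, (u : gl (m + 1)) ∈ upperTriangular (m + 1) ∧
      (∀ j, ((g * u : GL (Fin (m + 1)) ℂ) : gl (m + 1)) (Fin.last m) j = if j = i then 1 else 0) ∧
      ∀ j, ((g * u : GL (Fin (m + 1)) ℂ) : gl (m + 1)) j i = if j = Fin.last m then 1 else 0 := by
  set r : Fin (m + 1) → ℂ := fun j => (g : gl (m + 1)) (Fin.last m) j with hr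
  set w : Fin (m + 1) → ℂ := fun j => ((g⁻¹ : GL (Fin (m + 1)) ℂ) : gl (m + 1)) j (Fin.last m)
    with hw
  have hr0 : ∀ j < i, r j = 0 := hg.1
  have hw0 : ∀ j, i < j → w j = 0 := hg.2
  have hgw : ∀ a, ∑ l, (g : gl (m + 1)) a l * w l = if a = Fin.last m then 1 else 0 := by
    intro a
    have h := congrFun (congrFun (Units.mul_inv g) a) (Fin.last m)
    rwa [mul_apply, one_apply] at h
  -- In `r · w = 1` only the `i`-th term survives.
  have hwi : w i ≠ 0 := by
    have h := hgw (Fin.last m)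
    rw [Finset.sum_eq_single i, if_pos rfl] at h
    · exact right_ne_zero_of_mul_eq_one h
    · intro l _ hl
      rcases lt_or_gt_of_ne hl with h | h
      · rw [show (g : gl (m + 1)) (Fin.last m) l = 0 from hr0 l h, zero_mul]
      · rw [hw0 l h, mul_zero]
    · simp
  -- Column `i` is `w`, which `g` sends to the last coordinate vector; the other columns `e_j - r j
  -- • w` remove the last entry of column `j` of `g`. The vanishing of `r` before `i` and of `w`
  -- after `i` makes `U` triangular, with diagonal entries `w i` and `1`.
  let U : gl (m + 1) := Matrix.of fun a j =>
    if j = i then w a else (if a = j then 1 else 0) - r j * w a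
  have hU : U ∈ upperTriangular (m + 1) := by
    intro a j hja
    simp only [U, of_apply]
    split_ifs with h1 h2
    · exact hw0 a (h1 ▸ hja)
    · exact absurd h2 hja.ne'
    · rcases lt_or_gt_of_ne h1 with h | h
      · rw [hr0 j h]; simp
      · rw [hw0 a (h.trans hja)]; simp
  have hdet : IsUnit U.det := by
    rw [det_of_isUpperTriangular (fun a j h => hU a j h), isUnit_iff_ne_zero,
      Finset.prod_ne_zero_iff]
    intro j _
    simp only [U, of_apply, if_true]
    split_ifs with h
    · rw [h]; exact hwi
    · rcases lt_or_gt_of_ne h with h | h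
      · rw [hr0 j h]; simp
      · rw [hw0 j h]; simp
  obtain ⟨u, hu⟩ := (isUnit_iff_isUnit_det U).2 hdet
  have hmul : ∀ a j, ((g * u : GL (Fin (m + 1)) ℂ) : gl (m + 1)) a j =
      if j = i then (if a = Fin.last m then 1 else 0)
      else (g : gl (m + 1)) a j - r j * (if a = Fin.last m then 1 else 0) := by
    intro a j
    rw [Units.val_mul, hu, mul_apply]
    by_cases h : j = i
    · simp only [U, of_apply, h, if_true, hgw]
    · simp only [U, of_apply, h, if_false, mul_sub, Finset.sum_sub_distrib]
      rw [← hgw a, Finset.mul_sum]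
      congr 1
      · simp
      · exact Finset.sum_congr rfl fun l _ => by ring
  refine ⟨u, hu ▸ hU, fun j => ?_, fun j => ?_⟩
  · rw [hmul]
    split_ifs <;> simp_all
  · rw [hmul, if_pos rfl]

/-- The group `K` acts transitively on the flags of a stratum. -/
theorem exists_mem_K_smul_stdBorel_eq {m : ℕ} {i : Fin (m + 1)} {g g' : GL (Fin (m + 1)) ℂ}
    (hg : g ∈ closedStratum m i) (hg' : g' ∈ closedStratum m i) :
    ∃ k ∈ K m, k • g • stdBorel (m + 1) = g' • stdBorel (m + 1) := by
  obtain ⟨u, hu, hrow, hcol⟩ := exists_mul_upperTriangular_of_mem_closedStratum hg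
  obtain ⟨u', hu', hrow', hcol'⟩ := exists_mul_upperTriangular_of_mem_closedStratum hg'
  set h := g * u
  set h' := g' * u'
  have hinv_col : ∀ j, ((h⁻¹ : GL (Fin (m + 1)) ℂ) : gl (m + 1)) j (Fin.last m) =
      if j = i then 1 else 0 := by
    intro j
    have e := congrFun (congrFun (Units.inv_mul h) j) i
    rw [mul_apply, one_apply] at e
    simpa [hcol] using e
  have hinv_row : ∀ j, ((h⁻¹ : GL (Fin (m + 1)) ℂ) : gl (m + 1)) i j =
      if j = Fin.last m then 1 else 0 := by
    intro j
    have e := congrFun (congrFun (Units.mul_inv h) (Fin.last m)) j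
    rw [mul_apply, one_apply] at e
    simpa [hrow, eq_comm] using e
  -- `h` and `h'` both send `e_i` to `e_last`, and both have last row `e_iᵀ`, so `h' * h⁻¹` fixes
  -- `e_last` as a column and as a row.
  refine ⟨h' * h⁻¹, fun l => ⟨?_, ?_⟩, ?_⟩
  · rw [Units.val_mul, mul_apply]
    simp [hinv_col, hcol', (Fin.castSucc_lt_last l).ne]
  · rw [Units.val_mul, mul_apply]
    simp [-coe_units_inv, hinv_row, hrow', (Fin.castSucc_lt_last l).ne]
  · have e1 : g • stdBorel (m + 1) = h • stdBorel (m + 1) := by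
      rw [mul_smul, smul_stdBorel_of_mem_upperTriangular hu]
    have e2 : g' • stdBorel (m + 1) = h' • stdBorel (m + 1) := by
      rw [mul_smul, smul_stdBorel_of_mem_upperTriangular hu']
    rw [e1, e2, smul_smul, inv_mul_cancel_right]

/-- In the quotient topology it is enough that the preimage of the orbit is the whole stratum:
invariance gives one inclusion, transitivity of `K` the other. -/
theorem isClosed_orbit_of_mem_closedStratum {m : ℕ} {i : Fin (m + 1)} {g : GL (Fin (m + 1)) ℂ}
    (hg : g ∈ closedStratum m i) :
    IsClosed (MulAction.orbit (K m) (g • stdBorel (m + 1))) := by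
  refine isClosed_coinduced.2 ?_
  convert isClosed_closedStratum m i using 1
  ext g'
  constructor
  · rintro ⟨⟨k, hk⟩, h⟩
    have h' : k • g • stdBorel (m + 1) = g' • stdBorel (m + 1) := h
    have h1 : ((k * g)⁻¹ * g') • stdBorel (m + 1) = stdBorel (m + 1) := by
      rw [mul_smul, ← h', smul_smul k, inv_smul_smul]
    have h2 : ((k * g)⁻¹ * g')⁻¹ • stdBorel (m + 1) = stdBorel (m + 1) := by
      rw [inv_smul_eq_iff, h1]
    have h3 := mul_mem_closedStratum_of_mem_upperTriangular
      (mul_mem_closedStratum_of_mem_K hk hg)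
      (mem_upperTriangular_of_smul_stdBorel h1) (mem_upperTriangular_of_smul_stdBorel h2)
    rwa [mul_inv_cancel_left] at h3
  · intro hg'
    obtain ⟨k, hk, h⟩ := exists_mem_K_smul_stdBorel_eq hg hg'
    exact ⟨⟨k, hk⟩, h⟩

/-! ### From nilpotent corners to strata -/

/-- A regular nilpotent strictly upper triangular matrix lowers the support of a vector by exactly
one step. -/
theorem pow_mulVec_support {n : ℕ} {M : gl n} (hM : M ∈ upperTriangular n)
    (hreg : IsRegularNilpotent M) {w : Fin n → ℂ} {i : Fin n} (hi : w i ≠ 0)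
    (hw : ∀ j, i < j → w j = 0) (k : ℕ) :
    (∀ a : Fin n, (i : ℕ) < a + k → (M ^ k *ᵥ w) a = 0) ∧
      ∀ a : Fin n, (a : ℕ) + k = i → (M ^ k *ᵥ w) a ≠ 0 := by
  have hdiag := diag_eq_zero_of_isNilpotent hM hreg.2
  induction k with
  | zero =>
    simp only [pow_zero, one_mulVec, add_zero]
    exact ⟨fun a h => hw a h, fun a h => by rwa [Fin.ext h]⟩
  | succ k ih =>
    have hle : ∀ a l : Fin n, (l : ℕ) ≤ a → M a l = 0 := by
      intro a l h
      rcases lt_or_eq_of_le h with h | h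
      · exact hM a l h
      · rw [Fin.ext h, hdiag]
    have hsucc : ∀ a, (M ^ (k + 1) *ᵥ w) a = ∑ l, M a l * (M ^ k *ᵥ w) l := by
      intro a
      rw [pow_succ', ← mulVec_mulVec]
      rfl
    refine ⟨fun a h => ?_, fun a h => ?_⟩
    · rw [hsucc]
      refine Finset.sum_eq_zero fun l _ => ?_
      by_cases hl : (l : ℕ) ≤ a
      · rw [hle a l hl, zero_mul]
      · rw [ih.1 l (by omega), mul_zero]
    · have hlt : (a : ℕ) + 1 < n := by have := i.2; omega
      rw [hsucc, Finset.sum_eq_single ⟨a + 1, hlt⟩]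
      · exact mul_ne_zero (superdiag_ne_zero hM hreg rfl)
          (ih.2 _ (by change (a : ℕ) + 1 + k = i; omega))
      · intro l _ hne
        have hne' : (l : ℕ) ≠ a + 1 := fun e => hne (Fin.ext e)
        by_cases hl : (l : ℕ) ≤ a
        · rw [hle a l hl, zero_mul]
        · rw [ih.1 l (by omega), mul_zero]
      · simp

theorem exists_mem_closedStratum {m : ℕ} {g : GL (Fin (m + 1)) ℂ} {x : gl (m + 1)}
    (hx : x ∈ adMap g (upperTriangular (m + 1))) (hreg : IsRegularNilpotent x)
    (hc : IsNilpotent (corner x)) : ∃ i, g ∈ closedStratum m i := by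
  let M : gl (m + 1) := ((g⁻¹ : GL (Fin (m + 1)) ℂ) : gl (m + 1)) * x * (g : gl (m + 1))
  have hM : M ∈ upperTriangular (m + 1) := (mem_adMap g _ x).1 hx
  have hMreg : IsRegularNilpotent M := by
    refine ⟨?_, isNilpotent_conj g hreg.2⟩
    have h := (isKostantRegular_adEquiv_iff g⁻¹).2 hreg.1
    rwa [adEquiv_apply, inv_inv] at h
  let w : Fin (m + 1) → ℂ := fun j => ((g⁻¹ : GL (Fin (m + 1)) ℂ) : gl (m + 1)) j (Fin.last m)
  have hw : ∃ i, w i ≠ 0 := by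
    by_contra! h
    have e := congrFun (congrFun (Units.mul_inv g) (Fin.last m)) (Fin.last m)
    rw [mul_apply, one_apply_eq, Finset.sum_eq_zero] at e
    · exact zero_ne_one e
    · intro l _
      rw [show ((g⁻¹ : GL (Fin (m + 1)) ℂ) : gl (m + 1)) l (Fin.last m) = 0 from h l, mul_zero]
  obtain ⟨i, hi⟩ := (Set.toFinite {i | w i ≠ 0}).exists_maximal hw
  have hw0 : ∀ j, i < j → w j = 0 := by
    intro j hj
    by_contra h
    exact absurd (hi.2 h hj.le) (not_le.2 hj)
  have hsupp := pow_mulVec_support hM hMreg hi.1 hw0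
  have hzero : ∀ k : ℕ, 1 ≤ k →
      ∑ l, (g : gl (m + 1)) (Fin.last m) l * (M ^ k *ᵥ w) l = 0 := by
    intro k hk
    have h1 : (g : gl (m + 1)) * (M ^ k * ((g⁻¹ : GL (Fin (m + 1)) ℂ) : gl (m + 1))) = x ^ k := by
      simp only [M, Units.conj_pow', ← mul_assoc, Units.mul_inv, one_mul]
      rw [mul_assoc, Units.mul_inv, mul_one]
    rw [← pow_apply_last_eq_zero hreg.2 hc k hk, ← h1]
    rfl
  refine ⟨i, ?_, hw0⟩
  suffices H : ∀ a : ℕ, ∀ j : Fin (m + 1), (j : ℕ) = a → j < i →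
      (g : gl (m + 1)) (Fin.last m) j = 0 from fun j hj => H j j rfl hj
  intro a
  induction a using Nat.strong_induction_on with
  | _ a ih =>
    intro j hja hji
    rw [Fin.lt_def] at hji
    -- With exponent `i - j`, the vector `M ^ (i - j) *ᵥ w` is zero above `j` and nonzero at `j`,
    -- while the last row of `g` is zero before `j` by induction; only the `j`-th term is left.
    have h1 := hzero (i - j) (by omega)
    rw [Finset.sum_eq_single j] at h1
    · exact (mul_eq_zero.1 h1).resolve_right ((hsupp _).2 j (by omega))
    · intro l _ hl
      have hl' : (l : ℕ) ≠ j := fun e => hl (Fin.ext e)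
      by_cases hlj : (l : ℕ) < j
      · rw [ih l (by omega) l rfl (by rw [Fin.lt_def]; omega), zero_mul]
      · rw [(hsupp _).1 l (by omega), mul_zero]
    · simp

theorem isClosed_orbit_of_isNilpotent_corner {m : ℕ} {b : FlagVariety (m + 1)} {x : gl (m + 1)}
    (hx : x ∈ b.1) (hreg : IsRegularNilpotent x) (hc : IsNilpotent (corner x)) :
    IsClosed (MulAction.orbit (K m) b) := by
  obtain ⟨g, rfl⟩ := exists_smul_stdBorel_eq b
  obtain ⟨i, hi⟩ := exists_mem_closedStratum hx hreg hc
  exact isClosed_orbit_of_mem_closedStratum hi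

theorem corner_projK {m : ℕ} (x : gl (m + 1)) : corner (projK x) = corner x := by
  ext i j
  simp [corner, projK, (Fin.castSucc_lt_last _).ne]

/-- On block diagonal matrices, taking the corner is multiplicative. -/
theorem isNilpotent_corner {m : ℕ} {y : gl (m + 1)} (hy : y ∈ nilconeK m) :
    IsNilpotent (corner y) := by
  obtain ⟨hb, k, hk⟩ := hy
  have key : ∀ k : ℕ, corner (y ^ k) = corner y ^ k := by
    intro k
    induction k with
    | zero => ext i j; simp [corner, one_apply]
    | succ k ih =>
      rw [pow_succ, pow_succ, ← ih]
      ext i j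
      simp [corner, mul_apply, Fin.sum_univ_castSucc, (hb j).2]
  refine ⟨k, ?_⟩
  rw [← key, hk]
  rfl

end KOrbits

theorem theorem3p2 (m : ℕ) :
    (∀ b : KOrbits.FlagVariety (m + 1),
      ¬ IsClosed (MulAction.orbit (KOrbits.K m) b) →
        (KOrbits.projK '' KOrbits.nreg b) ∩ KOrbits.nilconeK m = ∅) ∧
    (∀ (b : KOrbits.FlagVariety (m + 1)) (x : KOrbits.gl (m + 1)), x ∈ b.1 →
      KOrbits.IsRegularNilpotent (KOrbits.corner x) → KOrbits.IsRegularNilpotent x →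
        IsClosed (MulAction.orbit (KOrbits.K m) b)) := by
  refine ⟨fun b hb => ?_, fun b x hx hc hreg =>
    KOrbits.isClosed_orbit_of_isNilpotent_corner hx hreg hc.2⟩
  rw [Set.eq_empty_iff_forall_notMem]
  rintro _ ⟨⟨x, ⟨hx, hreg⟩, rfl⟩, hy⟩
  -- `projK` leaves the corner unchanged, so a nilpotent projection would force the orbit to be
  -- closed.
  have hc := KOrbits.isNilpotent_corner hy
  rw [KOrbits.corner_projK] at hc
  exact hb (KOrbits.isClosed_orbit_of_isNilpotent_corner hx hreg hc)
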